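/- For integers $m,k\ge 0$ let $K(m,k)$ be the Kneser graph: its vertices are the $k$-element subsets of $\{1,\dots,m\}$, and two distinct vertices are adjacent if and only if they are disjoint. For a finite graph $G$ let $\mathcal{I}^r(G)$ be the family of all independent sets of $G$ of size $r$, and for a vertex $v$ of $G$ let $\mathcal{I}^r_v(G)=\{S\in\mathcal{I}^r(G): v\in S\}$, the star centered at $v$. A family $\mathcal{A}$ of sets is intersecting if $S\cap T\neq\emptyset$ for all $S,T\in\mathcal{A}$ (including $S=T$). The family $\mathcal{I}^r(G)$ is strictly EKR if (i) every intersecting family $\mathcal{A}\subseteq\mathcal{I}^r(G)$ satisfies $|\mathcal{A}|\le\max_{v\in V(G)}|\mathcal{I}^r_v(G)|$, and (ii) every intersecting family $\mathcal{A}\subseteq\mathcal{I}^r(G)$ of maximum size equals $\mathcal{I}^r_v(G)$ for some vertex $v$. Corollary. Let $n\ge 1$ and $0\le r\le n-1$ be integers, and let $\overline{K(2n,2)}$ be the complement of the Kneser graph $K(2n,2)$. Then $\mathcal{I}^r(\overline{K(2n,2)})$ is strictly EKR. -/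

import Mathlib

/-- The Kneser graph `K(m, k)`: the vertices are the `k`-subsets of an `m`-element set, and two
distinct vertices are adjacent when they are disjoint. (Distinctness only matters for `k = 0`,
where it excludes a loop.) -/
def kneserGraph (m k : ℕ) : SimpleGraph {A : Finset (Fin m) // A.card = k} where
  Adj A B := A ≠ B ∧ Disjoint A.1 B.1
  symm := ⟨fun _ _ h => ⟨h.1.symm, h.2.symm⟩⟩
  loopless := ⟨fun _ h => h.1 rfl⟩

instance kneserGraph.decidableAdj (m k : ℕ) : DecidableRel (kneserGraph m k).Adj :=
  fun A B => inferInstanceAs (Decidable (A ≠ B ∧ Disjoint A.1 B.1))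

namespace SimpleGraph

variable {V : Type*} [Fintype V] [DecidableEq V] (G : SimpleGraph V) [DecidableRel G.Adj]

/-- The star centered at `v`: all independent sets of `G` of size `r` that contain `v`. -/
def indepStar (r : ℕ) (v : V) : Finset (Finset V) :=
  (G.indepSetFinset r).filter (fun s => v ∈ s)

/-- `A` is an intersecting family of independent sets of size `r` of `G`. -/
def IsIntersectingIndepFamily (r : ℕ) (A : Finset (Finset V)) : Prop :=
  A ⊆ G.indepSetFinset r ∧ (A : Set (Finset V)).Intersecting

/-- The family of independent `r`-sets of `G` is EKR: no intersecting subfamily is larger than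
the largest star. -/
def IndepIsEKR (r : ℕ) : Prop :=
  ∀ A : Finset (Finset V), G.IsIntersectingIndepFamily r A →
    A.card ≤ Finset.univ.sup (fun v : V => (G.indepStar r v).card)

/-- The family of independent `r`-sets of `G` is strictly EKR: it is EKR, and every intersecting
subfamily of maximum size is a star. -/
def IndepIsStrictlyEKR (r : ℕ) : Prop :=
  G.IndepIsEKR r ∧
    ∀ A : Finset (Finset V), G.IsIntersectingIndepFamily r A →
      (∀ B : Finset (Finset V), G.IsIntersectingIndepFamily r B → B.card ≤ A.card) →
      ∃ v : V, A = G.indepStar r v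

end SimpleGraph

/-!
Katona's cycle method. All pairs from a set of `2 * h + 2` points can be arranged in one cyclic
sequence in which any `h` consecutive pairs are disjoint: run through the rounds of the
round-robin tournament in order. For `r ≤ h` an intersecting family contains at most `r` of the
windows of `r` consecutive pairs, whereas a star contains at least `r` of them, and averaging over
all labellings of the points gives the bound.

If the bound is attained, then in every labelling the windows in the family are exactly those
through some central pair. Relabellings that fix all pairs at the first `h + 1` positions to one
side of the center do not move the center, and the transpositions among them generate the
stabilizer of the central pair. Since this stabilizer is transitive on the sets of `r` disjoint
pairs through the central pair, the family contains a whole star.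
-/

/-- The two-element subsets of `U`: the vertices of the graphs `K(m, 2)` when `U` is `Fin m`. -/
abbrev VertexPair (U : Type*) : Type _ := {A : Finset U // A.card = 2}

/-- A set of `r` pairwise disjoint pairs, that is, an independent `r`-set of the complement of
`K(m, 2)`. -/
def IsRMatching {U : Type*} (r : ℕ) (M : Finset (VertexPair U)) : Prop :=
  (M : Set (VertexPair U)).PairwiseDisjoint Subtype.val ∧ M.card = r

/-- The bijection between pairs induced by a bijection of the underlying types. -/
def pairCongr {U W : Type*} (σ : U ≃ W) : VertexPair U ≃ VertexPair W :=
  σ.finsetCongr.subtypeEquiv fun A => by simp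

section Pairs

variable {U W X : Type*} {r : ℕ}

theorem coe_pairCongr (σ : U ≃ W) (x : VertexPair U) :
    (pairCongr σ x : Finset W) = (x : Finset U).map σ.toEmbedding := rfl

theorem pairCongr_trans (σ : U ≃ W) (τ : W ≃ X) (x : VertexPair U) :
    pairCongr (σ.trans τ) x = pairCongr τ (pairCongr σ x) :=
  Subtype.ext (by simp only [coe_pairCongr, Finset.map_map, Equiv.trans_toEmbedding])

theorem map_pairCongr_trans (σ : U ≃ W) (τ : W ≃ X) (M : Finset (VertexPair U)) :
    M.map (pairCongr (σ.trans τ)).toEmbedding =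
      (M.map (pairCongr σ).toEmbedding).map (pairCongr τ).toEmbedding := by
  rw [Finset.map_map]
  exact congrArg (M.map ·) (DFunLike.ext _ _ (pairCongr_trans σ τ))

theorem mem_pairCongr_iff {σ : U ≃ W} {x : VertexPair U} {a : U} :
    σ a ∈ (pairCongr σ x : Finset W) ↔ a ∈ (x : Finset U) :=
  Finset.mem_map' _

theorem IsRMatching.map_pairCongr {M : Finset (VertexPair U)} (hM : IsRMatching r M)
    (σ : U ≃ W) : IsRMatching r (M.map (pairCongr σ).toEmbedding) := by
  refine ⟨?_, (Finset.card_map _).trans hM.2⟩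
  rw [Finset.coe_map]
  rintro _ ⟨x, hx, rfl⟩ _ ⟨y, hy, rfl⟩ hxy
  exact (Finset.disjoint_map σ.toEmbedding).2 (hM.1 hx hy fun h => hxy (congrArg _ h))

theorem map_pairCongr_eq_of_extends {M : Finset (VertexPair U)} {M' : Finset (VertexPair W)}
    {σ : U ≃ W} (φ : M ≃ M') (hσ : ∀ x : M, pairCongr σ x = φ x) :
    M.map (pairCongr σ).toEmbedding = M' := by
  refine Finset.eq_of_subset_of_card_le ?_ ?_
  · intro y hy
    obtain ⟨x, hx, rfl⟩ := Finset.mem_map.1 hy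
    exact (hσ ⟨x, hx⟩).symm ▸ (φ ⟨x, hx⟩).2
  · rw [Finset.card_map, Finset.card_eq_of_equiv φ]

theorem pairCongr_swap_eq_self [DecidableEq U] {x y : VertexPair U} {a b : U}
    (hx : (x : Finset U) = {a, b}) (hxy : y = x ∨ Disjoint (x : Finset U) y) :
    pairCongr (Equiv.swap a b) y = y := by
  refine Subtype.ext ?_
  rw [coe_pairCongr]
  rcases hxy with rfl | hdisj
  · rw [hx, Finset.map_insert, Finset.map_singleton]
    simp [Finset.pair_comm]
  · have fixes : ∀ c ∈ (y : Finset U), Equiv.swap a b c = c := by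
      intro c hc
      have hcx : c ∉ ({a, b} : Finset U) := hx ▸ Finset.disjoint_right.1 hdisj hc
      simp only [Finset.mem_insert, Finset.mem_singleton, not_or] at hcx
      exact Equiv.swap_apply_of_ne_of_ne hcx.1 hcx.2
    rw [Finset.map_eq_image]
    exact (Finset.image_congr fixes).trans Finset.image_id

end Pairs

section Transitivity

open Function

variable {ι U : Type*} [Finite U] {r : ℕ}

theorem exists_perm_map_eq {s t : ι → Finset U} (hs : Pairwise (Disjoint on s))
    (ht : Pairwise (Disjoint on t)) (hst : ∀ i, (s i).card = (t i).card) :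
    ∃ π : Equiv.Perm U, ∀ i, (s i).map π.toEmbedding = t i := by
  classical
  have coe_disjoint {u : ι → Finset U} (hu : Pairwise (Disjoint on u)) :
      Pairwise (Disjoint on fun i => (u i : Set U)) :=
    fun i j hij => Finset.disjoint_coe.2 (hu hij)
  let toSigma := Set.unionEqSigmaOfDisjoint (coe_disjoint hs)
  let ofSigma := (Set.unionEqSigmaOfDisjoint (coe_disjoint ht)).symm
  let blocks (i : ι) : (s i : Set U) ≃ (t i : Set U) := Finset.equivOfCardEq (hst i)
  let φ := (toSigma.trans (Equiv.sigmaCongrRight blocks)).trans ofSigma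
  refine ⟨φ.extendSubtype, fun i => Finset.eq_of_subset_of_card_le ?_ ?_⟩
  · intro y hy
    obtain ⟨x, hx, rfl⟩ := Finset.mem_map.1 hy
    have toSigma_x : toSigma ⟨x, Set.mem_iUnion.2 ⟨i, hx⟩⟩ = ⟨i, ⟨x, hx⟩⟩ :=
      toSigma.eq_symm_apply.1 (Subtype.ext (by simp [toSigma]))
    have φ_x : (φ ⟨x, Set.mem_iUnion.2 ⟨i, hx⟩⟩ : U) = blocks i ⟨x, hx⟩ := by
      simp [φ, toSigma_x, ofSigma]
    rw [Equiv.coe_toEmbedding, Equiv.extendSubtype_apply_of_mem φ x (Set.mem_iUnion.2 ⟨i, hx⟩), φ_x]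
    exact (blocks i ⟨x, hx⟩).2
  · rw [Finset.card_map, hst]

theorem IsRMatching.exists_perm_extends {M M' : Finset (VertexPair U)} (hM : IsRMatching r M)
    (hM' : IsRMatching r M') (φ : M ≃ M') :
    ∃ π : Equiv.Perm U, ∀ x : M, pairCongr π x = φ x := by
  obtain ⟨π, hπ⟩ := exists_perm_map_eq (s := fun x : M => x.1.1) (t := fun x : M => (φ x).1.1)
    (fun x y hxy => hM.1 x.2 y.2 (Subtype.coe_injective.ne hxy))
    (fun x y hxy => hM'.1 (φ x).2 (φ y).2 (Subtype.coe_injective.ne (φ.injective.ne hxy)))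
    (fun x => x.1.2.trans (φ x).1.2.symm)
  exact ⟨π, fun x => Subtype.ext (hπ x)⟩

theorem IsRMatching.exists_perm_map_eq {M M' : Finset (VertexPair U)} (hM : IsRMatching r M)
    (hM' : IsRMatching r M') : ∃ π : Equiv.Perm U, M.map (pairCongr π).toEmbedding = M' := by
  let φ : M ≃ M' := Finset.equivOfCardEq (hM.2.trans hM'.2.symm)
  obtain ⟨π, hπ⟩ := hM.exists_perm_extends hM' φ
  exact ⟨π, map_pairCongr_eq_of_extends φ hπ⟩

theorem IsRMatching.exists_perm_map_eq_fixing {M M' : Finset (VertexPair U)} {x : VertexPair U}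
    (hM : IsRMatching r M) (hM' : IsRMatching r M') (hx : x ∈ M) (hx' : x ∈ M') :
    ∃ π : Equiv.Perm U, M.map (pairCongr π).toEmbedding = M' ∧ pairCongr π x = x := by
  classical
  let φ : M ≃ M' := (Finset.equivOfCardEq (hM.2.trans hM'.2.symm)).setValue ⟨x, hx⟩ ⟨x, hx'⟩
  obtain ⟨π, hπ⟩ := hM.exists_perm_extends hM' φ
  exact ⟨π, map_pairCongr_eq_of_extends φ hπ,
    (hπ ⟨x, hx⟩).trans (congrArg Subtype.val (Equiv.setValue_eq _ _ _))⟩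

theorem mem_subgroup_of_forall_swap_mem [DecidableEq U] {H : Subgroup (Equiv.Perm U)}
    {τ : Equiv.Perm U} (hswap : ∀ a, Equiv.swap a (τ a) ∈ H) : τ ∈ H := by
  let S : Set (Equiv.Perm U) := {f | f.IsSwap ∧ f ∈ H}
  have hS : Subgroup.closure S ≤ H := (Subgroup.closure_le H).2 fun f hf => hf.2
  refine hS ((mem_closure_isSwap fun f hf => hf.1).2 ⟨Set.toFinite _, fun a => ?_⟩)
  rw [← swap_mem_closure_isSwap fun f hf => hf.1, Equiv.swap_comm]
  by_cases ha : a = τ a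
  · rw [← ha, Equiv.swap_self]
    exact one_mem _
  · exact Subgroup.subset_closure ⟨⟨a, τ a, ha, rfl⟩, hswap a⟩

end Transitivity

section Windows

variable {β : Type*} [DecidableEq β]

/-- The set of the `r` consecutive terms of the sequence `e` that start at position `q`. -/
noncomputable def window (e : ℤ → β) (r : ℕ) (q : ℤ) : Finset β :=
  (Finset.Ico q (q + r)).image e

/-- The sequence `e` runs periodically through `N` different values. -/
def IsCyclicListing (e : ℤ → β) (N : ℤ) : Prop :=
  ∀ a b, e a = e b ↔ a ≡ b [ZMOD N]

/-- The number of windows of length `r` within one period `N` of `e` that belong to `𝓐`. -/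
noncomputable def windowCount (𝓐 : Finset (Finset β)) (e : ℤ → β) (N : ℤ) (r : ℕ) : ℕ :=
  ((Finset.Ico 0 N).filter fun q => window e r q ∈ 𝓐).card

/-- All `r` windows of length `r` that contain position `p` belong to `𝓐`. -/
def IsWindowCenter (𝓐 : Finset (Finset β)) (e : ℤ → β) (r : ℕ) (p : ℤ) : Prop :=
  ∀ q, p - r < q → q ≤ p → window e r q ∈ 𝓐

/-- Every window of length `r` of `e` that belongs to `𝓐` contains a window center. This is what
equality in Katona's bound `IsCyclicListing.windowCount_le` means. -/
def IsCentered (𝓐 : Finset (Finset β)) (e : ℤ → β) (r : ℕ) : Prop :=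
  ∀ a, window e r a ∈ 𝓐 → ∃ p, a ≤ p ∧ p < a + r ∧ IsWindowCenter 𝓐 e r p

variable {𝓐 : Finset (Finset β)} {e e' : ℤ → β} {N : ℤ} {r : ℕ}

theorem mem_window {q : ℤ} {x : β} : x ∈ window e r q ↔ ∃ a, (q ≤ a ∧ a < q + r) ∧ e a = x := by
  simp only [window, Finset.mem_image, Finset.mem_Ico]

theorem window_congr {a b : ℤ} (h : ∀ d : ℤ, 0 ≤ d → d < r → e (a + d) = e' (b + d)) :
    window e r a = window e' r b := by
  ext x
  simp only [mem_window]
  constructor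
  · rintro ⟨c, hc, rfl⟩
    exact ⟨b + (c - a), by omega, by rw [← h _ (by omega) (by omega), add_sub_cancel]⟩
  · rintro ⟨c, hc, rfl⟩
    exact ⟨a + (c - b), by omega, by rw [h _ (by omega) (by omega), add_sub_cancel]⟩

theorem IsCyclicListing.window_eq_of_modEq (he : IsCyclicListing e N) {a b : ℤ}
    (hab : a ≡ b [ZMOD N]) : window e r a = window e r b :=
  window_congr fun d _ _ => (he _ _).2 (hab.add_right d)

theorem IsCyclicListing.isWindowCenter_of_modEq (he : IsCyclicListing e N) {p p' : ℤ}
    (hpp' : p ≡ p' [ZMOD N]) (hp : IsWindowCenter 𝓐 e r p) : IsWindowCenter 𝓐 e r p' := by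
  intro q hq hqp
  have hmod : q + (p - p') ≡ q [ZMOD N] := by
    simpa using (hpp'.sub_right p').add_left q
  rw [← he.window_eq_of_modEq hmod]
  exact hp _ (by omega) (by omega)

theorem IsCyclicListing.exists_modEq_add (he : IsCyclicListing e N)
    (h𝓐 : (𝓐 : Set (Finset β)).Intersecting) {a b : ℤ} (ha : window e r a ∈ 𝓐)
    (hb : window e r b ∈ 𝓐) : ∃ d : ℤ, -r < d ∧ d < r ∧ b ≡ a + d [ZMOD N] := by
  obtain ⟨x, hxa, hxb⟩ := Finset.not_disjoint_iff.1 (h𝓐 ha hb)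
  obtain ⟨i, hi, rfl⟩ := mem_window.1 hxa
  obtain ⟨j, hj, hji⟩ := mem_window.1 hxb
  refine ⟨(i - a) - (j - b), by omega, by omega, ?_⟩
  have hmod : b - j + j ≡ b - j + i [ZMOD N] := ((he _ _).1 hji).add_left _
  convert hmod using 1 <;> ring

theorem IsCyclicListing.lt_add_of_window_mem (he : IsCyclicListing e N)
    (h𝓐 : (𝓐 : Set (Finset β)).Intersecting) {a b : ℤ} (ha : window e r a ∈ 𝓐)
    (hb : window e r b ∈ 𝓐) (hab : b + r ≤ a + N) : b < a + r := by
  by_contra! hba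
  obtain ⟨d, hd, hd', hmod⟩ := he.exists_modEq_add h𝓐 ha hb
  have hle : N ≤ b - (a + d) := Int.le_of_dvd (by omega) hmod.symm.dvd
  omega

/-- The positions, relative to `a`, of the windows of `e` in `𝓐` at distance less than `r`
from `a`. -/
noncomputable def nearbyWindows (𝓐 : Finset (Finset β)) (e : ℤ → β) (r : ℕ) (a : ℤ) : Finset ℤ :=
  (Finset.Ioo (-r : ℤ) r).filter fun d => window e r (a + d) ∈ 𝓐

theorem mem_nearbyWindows {a d : ℤ} :
    d ∈ nearbyWindows 𝓐 e r a ↔ (-r < d ∧ d < r) ∧ window e r (a + d) ∈ 𝓐 := by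
  simp only [nearbyWindows, Finset.mem_filter, Finset.mem_Ioo]

theorem IsCyclicListing.windowCount_le_card_nearbyWindows (he : IsCyclicListing e N)
    (h𝓐 : (𝓐 : Set (Finset β)).Intersecting) {a : ℤ} (ha : window e r a ∈ 𝓐) :
    windowCount 𝓐 e N r ≤ (nearbyWindows 𝓐 e r a).card := by
  refine (Finset.card_le_card ?_).trans (Finset.card_image_le (f := fun d => (a + d) % N))
  intro q hq
  obtain ⟨hqN, hq𝓐⟩ := Finset.mem_filter.1 hq
  rw [Finset.mem_Ico] at hqN
  obtain ⟨d, hd, hd', hmod⟩ := he.exists_modEq_add h𝓐 ha hq𝓐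
  refine Finset.mem_image.2 ⟨d, mem_nearbyWindows.2 ⟨⟨hd, hd'⟩, ?_⟩, ?_⟩
  · rwa [← he.window_eq_of_modEq hmod]
  · rw [← hmod, Int.emod_eq_of_lt hqN.1 hqN.2]

theorem IsCyclicListing.exists_nearbyWindows_subset (he : IsCyclicListing e N) (hr : 3 * r ≤ N)
    (h𝓐 : (𝓐 : Set (Finset β)).Intersecting) {a : ℤ} (ha : window e r a ∈ 𝓐) :
    ∃ m : ℤ, m ≤ 0 ∧ 0 < m + r ∧ nearbyWindows 𝓐 e r a ⊆ Finset.Ico m (m + r) := by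
  have hr0 : 0 < r := by
    obtain ⟨d, hd⟩ := he.exists_modEq_add h𝓐 ha ha
    omega
  have h0 : 0 ∈ nearbyWindows 𝓐 e r a := mem_nearbyWindows.2 ⟨by omega, by rwa [add_zero]⟩
  let m := (nearbyWindows 𝓐 e r a).min' ⟨0, h0⟩
  have hm := mem_nearbyWindows.1 (Finset.min'_mem _ ⟨0, h0⟩ : m ∈ nearbyWindows 𝓐 e r a)
  refine ⟨m, Finset.min'_le _ _ h0, by omega, fun d hd => Finset.mem_Ico.2 ⟨?_, ?_⟩⟩
  · exact Finset.min'_le _ _ hd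
  · have hd' := mem_nearbyWindows.1 hd
    have := he.lt_add_of_window_mem h𝓐 hm.2 hd'.2 (by omega)
    omega

theorem IsCyclicListing.windowCount_le (he : IsCyclicListing e N) (hr : 3 * r ≤ N)
    (h𝓐 : (𝓐 : Set (Finset β)).Intersecting) : windowCount 𝓐 e N r ≤ r := by
  rcases Finset.eq_empty_or_nonempty ((Finset.Ico 0 N).filter fun q => window e r q ∈ 𝓐)
    with hempty | ⟨a, ha⟩
  · simp [windowCount, hempty]
  · have ha𝓐 := (Finset.mem_filter.1 ha).2
    obtain ⟨m, -, -, hsub⟩ := he.exists_nearbyWindows_subset hr h𝓐 ha𝓐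
    calc windowCount 𝓐 e N r ≤ (nearbyWindows 𝓐 e r a).card :=
          he.windowCount_le_card_nearbyWindows h𝓐 ha𝓐
      _ ≤ (Finset.Ico m (m + r)).card := Finset.card_le_card hsub
      _ = r := by simp

theorem IsCyclicListing.isCentered_of_windowCount_eq (he : IsCyclicListing e N) (hr : 3 * r ≤ N)
    (h𝓐 : (𝓐 : Set (Finset β)).Intersecting) (hcount : windowCount 𝓐 e N r = r) :
    IsCentered 𝓐 e r := by
  intro a ha
  obtain ⟨m, hm, hmr, hsub⟩ := he.exists_nearbyWindows_subset hr h𝓐 ha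
  have heq : nearbyWindows 𝓐 e r a = Finset.Ico m (m + r) := by
    refine Finset.eq_of_subset_of_card_le hsub ?_
    calc (Finset.Ico m (m + r)).card = r := by simp
      _ = windowCount 𝓐 e N r := hcount.symm
      _ ≤ _ := he.windowCount_le_card_nearbyWindows h𝓐 ha
  refine ⟨a + m + r - 1, by omega, by omega, fun q hq hq' => ?_⟩
  have hmem : q - a ∈ nearbyWindows 𝓐 e r a := heq ▸ Finset.mem_Ico.2 ⟨by omega, by omega⟩
  simpa using (mem_nearbyWindows.1 hmem).2

theorem IsWindowCenter.le_windowCount {p : ℤ} (hp : IsWindowCenter 𝓐 e r p)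
    (he : IsCyclicListing e N) (hr : r < N) : r ≤ windowCount 𝓐 e N r := by
  have hinj : Set.InjOn (· % N) (Finset.Ioc (p - r) p : Set ℤ) := by
    intro a ha b hb hab
    rw [Finset.coe_Ioc, Set.mem_Ioc] at ha hb
    have hdvd : N ∣ b - a := Int.ModEq.dvd hab
    have := Int.eq_zero_of_abs_lt_dvd hdvd (abs_lt.2 ⟨by omega, by omega⟩)
    omega
  calc r = ((Finset.Ioc (p - r) p).image (· % N)).card := by
        rw [Finset.card_image_of_injOn hinj, Int.card_Ioc]; simp
    _ ≤ windowCount 𝓐 e N r := Finset.card_le_card fun q hq => by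
        obtain ⟨a, ha, rfl⟩ := Finset.mem_image.1 hq
        rw [Finset.mem_Ioc] at ha
        refine Finset.mem_filter.2 ⟨Finset.mem_Ico.2 ?_, ?_⟩
        · exact ⟨Int.emod_nonneg _ (by omega), Int.emod_lt_of_pos _ (by omega)⟩
        · rw [he.window_eq_of_modEq (Int.mod_modEq a N)]
          exact hp a ha.1 ha.2

theorem IsWindowCenter.window_sub_notMem {p : ℤ} (hp : IsWindowCenter 𝓐 e r p) (hr0 : 0 < r)
    (he : IsCyclicListing e N) (hr : 3 * r ≤ N) (h𝓐 : (𝓐 : Set (Finset β)).Intersecting) :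
    window e r (p - r) ∉ 𝓐 := fun hmem => by
  have := he.lt_add_of_window_mem h𝓐 hmem (hp p (by omega) le_rfl) (by omega)
  omega

theorem IsWindowCenter.window_add_one_notMem {p : ℤ} (hp : IsWindowCenter 𝓐 e r p) (hr0 : 0 < r)
    (he : IsCyclicListing e N) (hr : 3 * r ≤ N) (h𝓐 : (𝓐 : Set (Finset β)).Intersecting) :
    window e r (p + 1) ∉ 𝓐 := fun hmem => by
  have := he.lt_add_of_window_mem h𝓐 (hp (p - r + 1) (by omega) (by omega)) hmem (by omega)
  omega

theorem IsCentered.isWindowCenter_add (hc : IsCentered 𝓐 e r) {q : ℤ} (hq : window e r q ∉ 𝓐)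
    (hq' : window e r (q + 1) ∈ 𝓐) : IsWindowCenter 𝓐 e r (q + r) := by
  obtain ⟨p, hp, hp', hcenter⟩ := hc _ hq'
  obtain rfl : p = q + r := by
    by_contra hne
    exact hq (hcenter q (by omega) (by omega))
  exact hcenter

theorem IsCentered.isWindowCenter_self (hc : IsCentered 𝓐 e r) {q : ℤ} (hq : window e r q ∈ 𝓐)
    (hq' : window e r (q + 1) ∉ 𝓐) : IsWindowCenter 𝓐 e r q := by
  obtain ⟨p, hp, hp', hcenter⟩ := hc _ hq
  obtain rfl : p = q := by
    by_contra hne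
    exact hq' (hcenter (q + 1) (by omega) (by omega))
  exact hcenter

/-- The `r + 1` terms up to a center determine the last window outside `𝓐` and the first window
inside, which is enough to recognise the center in another centered sequence. -/
theorem IsWindowCenter.transfer_backward {p p' : ℤ} (hp : IsWindowCenter 𝓐 e r p)
    (he : IsCyclicListing e N) (hr : 3 * r ≤ N) (h𝓐 : (𝓐 : Set (Finset β)).Intersecting)
    (hc : IsCentered 𝓐 e' r) (h : ∀ d : ℤ, 0 ≤ d → d ≤ r → e (p - d) = e' (p' - d)) :
    IsWindowCenter 𝓐 e' r p' := by
  rcases Nat.eq_zero_or_pos r with rfl | hr0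
  · exact fun q hq hq' => by omega
  have shift {i : ℤ} (hi : i = 0 ∨ i = 1) :
      window e r (p - r + i) = window e' r (p' - r + i) := window_congr fun d hd hdr => by
    convert h (r - i - d) (by omega) (by omega) using 2 <;> ring
  have hout : window e' r (p' - r) ∉ 𝓐 := by
    have := shift (Or.inl rfl)
    rw [add_zero, add_zero] at this
    exact this ▸ hp.window_sub_notMem hr0 he hr h𝓐
  have hin : window e' r (p' - r + 1) ∈ 𝓐 := by
    rw [← shift (Or.inr rfl)]
    exact hp _ (by omega) (by omega)
  simpa using hc.isWindowCenter_add hout hin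

theorem IsWindowCenter.transfer_forward {p p' : ℤ} (hp : IsWindowCenter 𝓐 e r p)
    (he : IsCyclicListing e N) (hr : 3 * r ≤ N) (h𝓐 : (𝓐 : Set (Finset β)).Intersecting)
    (hc : IsCentered 𝓐 e' r) (h : ∀ d : ℤ, 0 ≤ d → d ≤ r → e (p + d) = e' (p' + d)) :
    IsWindowCenter 𝓐 e' r p' := by
  rcases Nat.eq_zero_or_pos r with rfl | hr0
  · exact fun q hq hq' => by omega
  have hin : window e' r p' ∈ 𝓐 := by
    rw [← window_congr fun d hd hdr => h d hd hdr.le]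
    exact hp p (by omega) le_rfl
  have hout : window e' r (p' + 1) ∉ 𝓐 := by
    have shift : window e r (p + 1) = window e' r (p' + 1) := window_congr fun d hd hdr => by
      simpa only [add_assoc] using h (1 + d) (by omega) (by omega)
    exact shift ▸ hp.window_add_one_notMem hr0 he hr h𝓐
  exact hc.isWindowCenter_self hin hout

end Windows

/-- The vertex set of size `2 * h + 2` on which the rotational sequence of pairs lives: the
residues modulo `2 * h + 1`, and a point `none` at infinity. -/
abbrev RotVertex (h : ℕ) : Type := Option (ZMod (2 * h + 1))

/-- The vertex given by the residue class of an integer. -/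
def residue (h : ℕ) (x : ℤ) : RotVertex h := some (x : ZMod (2 * h + 1))

/-- The first end of the `k`-th pair in row `t` of the rotational sequence. -/
def rowEnd (h : ℕ) (t k : ℤ) : RotVertex h := if k = 0 then none else residue h (t + k)

/-- The rotational sequence: row `t` consists of the pairs `{∞, t}` and `{t + k, t - k}` with
`1 ≤ k ≤ h`, which partition the vertex set, and the rows follow one another. -/
def rotSet (h : ℕ) (q : ℤ) : Finset (RotVertex h) :=
  {rowEnd h (q / (h + 1)) (q % (h + 1)), residue h (q / (h + 1) - q % (h + 1))}

section Rotation

variable {h : ℕ}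

theorem residue_eq_iff {x y : ℤ} : residue h x = residue h y ↔ x ≡ y [ZMOD 2 * h + 1] := by
  rw [residue, residue, Option.some_inj, ZMod.intCast_eq_intCast_iff]
  push_cast
  rfl

theorem eq_of_residue_eq {x y : ℤ} (hxy : residue h x = residue h y)
    (hlt : |y - x| < 2 * h + 1) : x = y :=
  (sub_eq_zero.1 (Int.eq_zero_of_abs_lt_dvd (residue_eq_iff.1 hxy).dvd hlt)).symm

theorem residue_ne_none {x : ℤ} : residue h x ≠ none := Option.some_ne_none _

theorem exists_row_coord (h : ℕ) (q : ℤ) :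
    ∃ t k : ℤ, 0 ≤ k ∧ k ≤ h ∧ q = t * (h + 1) + k :=
  ⟨q / (h + 1), q % (h + 1), Int.emod_nonneg _ (by omega),
    Int.lt_add_one_iff.1 (Int.emod_lt_of_pos q (by omega)), (Int.ediv_mul_add_emod q _).symm⟩

theorem rotSet_row {t k : ℤ} (hk0 : 0 ≤ k) (hk : k ≤ h) :
    rotSet h (t * (h + 1) + k) = {rowEnd h t k, residue h (t - k)} := by
  have hdiv : (t * ((h : ℤ) + 1) + k) / (h + 1) = t := by
    rw [Int.add_comm, Int.add_mul_ediv_right _ _ (by omega), Int.ediv_eq_zero_of_lt hk0 (by omega),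
      zero_add]
  have hmod : (t * ((h : ℤ) + 1) + k) % (h + 1) = k := by
    rw [Int.add_comm, Int.add_mul_emod_self_right, Int.emod_eq_of_lt hk0 (by omega)]
  rw [rotSet, hdiv, hmod]

theorem rowEnd_ne_residue {t k s l : ℤ}
    (hne : k ≠ 0 → s - l ≠ t + k ∧ |s - l - (t + k)| < 2 * h + 1) :
    rowEnd h t k ≠ residue h (s - l) := by
  rw [rowEnd]
  split_ifs with hk
  · exact residue_ne_none.symm
  · exact fun heq => (hne hk).1 (eq_of_residue_eq heq (hne hk).2).symm

theorem card_rotSet (h : ℕ) (q : ℤ) : (rotSet h q).card = 2 := by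
  obtain ⟨t, k, hk0, hk, rfl⟩ := exists_row_coord h q
  rw [rotSet_row hk0 hk]
  exact Finset.card_pair (rowEnd_ne_residue fun _ => ⟨by omega, abs_lt.2 ⟨by omega, by omega⟩⟩)

theorem disjoint_rotSet_rows {t k s l : ℤ} (hk : k ≤ h) (hl : l ≤ h) (hk0 : 0 ≤ k) (hl0 : 0 ≤ l)
    (hrow : s = t ∧ k < l ∨ s = t + 1 ∧ l + 2 ≤ k) :
    Disjoint (rotSet h (t * (h + 1) + k)) (rotSet h (s * (h + 1) + l)) := by
  rw [rotSet_row hk0 hk, rotSet_row hl0 hl]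
  have ends_ne : rowEnd h t k ≠ rowEnd h s l := by
    unfold rowEnd
    split_ifs with hk' hl' hl'
    · omega
    · exact residue_ne_none.symm
    · exact residue_ne_none
    · intro heq
      have := eq_of_residue_eq heq (abs_lt.2 ⟨by omega, by omega⟩)
      omega
  have residues_ne : residue h (t - k) ≠ residue h (s - l) := fun heq => by
    have := eq_of_residue_eq heq (abs_lt.2 ⟨by omega, by omega⟩)
    omega
  have end_ne_residue : rowEnd h t k ≠ residue h (s - l) :=
    rowEnd_ne_residue fun _ => ⟨by omega, abs_lt.2 ⟨by omega, by omega⟩⟩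
  have residue_ne_end : residue h (t - k) ≠ rowEnd h s l :=
    (rowEnd_ne_residue fun _ => ⟨by omega, abs_lt.2 ⟨by omega, by omega⟩⟩).symm
  simp [ends_ne.symm, residues_ne.symm, end_ne_residue.symm, residue_ne_end.symm]

theorem disjoint_rotSet_of_lt {a b : ℤ} (hab : a < b) (hba : b < a + h) :
    Disjoint (rotSet h a) (rotSet h b) := by
  obtain ⟨t, k, hk0, hk, rfl⟩ := exists_row_coord h a
  obtain ⟨d, rfl⟩ : ∃ d, b = t * (h + 1) + k + d := ⟨b - (t * (h + 1) + k), by ring⟩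
  by_cases hd : k + d ≤ h
  · rw [add_assoc]
    exact disjoint_rotSet_rows hk hd hk0 (by omega) (.inl ⟨rfl, by omega⟩)
  · rw [show t * ((h : ℤ) + 1) + k + d = (t + 1) * (h + 1) + (k + d - (h + 1)) by ring]
    exact disjoint_rotSet_rows hk (by omega) hk0 (by omega) (.inr ⟨rfl, by omega⟩)

theorem disjoint_rotSet_of_ne {a b : ℤ} (hab : a ≠ b) (hlt : |a - b| < h) :
    Disjoint (rotSet h a) (rotSet h b) := by
  rw [abs_lt] at hlt
  rcases lt_or_gt_of_ne hab with hlt' | hgt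
  · exact disjoint_rotSet_of_lt hlt' (by omega)
  · exact (disjoint_rotSet_of_lt hgt (by omega)).symm

/-- The rotational sequence as a sequence of pairs. -/
def rotPair (h : ℕ) (q : ℤ) : VertexPair (RotVertex h) := ⟨rotSet h q, card_rotSet h q⟩

/-- The period of the rotational sequence. -/
abbrev rotPeriod (h : ℕ) : ℤ := (2 * h + 1) * (h + 1)

theorem exists_rotSet_none (x : ZMod (2 * h + 1)) : ∃ q, rotSet h q = {none, some x} := by
  refine ⟨x.valMinAbs * (h + 1) + 0, ?_⟩
  rw [rotSet_row le_rfl (by omega), rowEnd, if_pos rfl, sub_zero, residue, ZMod.coe_valMinAbs]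

/-- The pair `{x, y}` of residues lies in the row of its midpoint; as `2 * (h + 1) = 1`, this is
`(h + 1) * (x + y)`. -/
theorem exists_rotSet_some {x y : ZMod (2 * h + 1)} (hxy : x ≠ y) :
    ∃ q, rotSet h q = {some x, some y} := by
  let t := ((h + 1) * (x + y)).valMinAbs
  let c := ((h + 1) * (x - y)).valMinAbs
  have two_mul_eq : (2 : ZMod (2 * h + 1)) * (h + 1) = 1 := by
    have hzero : ((2 * h + 1 : ℕ) : ZMod (2 * h + 1)) = 0 := ZMod.natCast_self _
    push_cast at hzero
    linear_combination hzero
  have residue_add : residue h (t + c) = some x := by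
    refine congrArg some ?_
    rw [Int.cast_add, ZMod.coe_valMinAbs, ZMod.coe_valMinAbs]
    linear_combination x * two_mul_eq
  have residue_sub : residue h (t - c) = some y := by
    refine congrArg some ?_
    rw [Int.cast_sub, ZMod.coe_valMinAbs, ZMod.coe_valMinAbs]
    linear_combination y * two_mul_eq
  have c_ne : c ≠ 0 := fun hc => hxy <| by
    rw [hc, add_zero] at residue_add
    rw [hc, sub_zero, residue_add] at residue_sub
    exact Option.some_inj.1 residue_sub
  have c_le : c.natAbs ≤ h := (ZMod.natAbs_valMinAbs_le _).trans (by omega)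
  rcases lt_or_gt_of_ne c_ne with hneg | hpos
  · refine ⟨t * (h + 1) + -c, ?_⟩
    rw [rotSet_row (by omega) (by omega), rowEnd, if_neg (by omega), sub_neg_eq_add,
      ← sub_eq_add_neg, residue_add, residue_sub, Finset.pair_comm]
  · refine ⟨t * (h + 1) + c, ?_⟩
    rw [rotSet_row (by omega) (by omega), rowEnd, if_neg c_ne, residue_add, residue_sub]

theorem rotPair_surjective (h : ℕ) : Function.Surjective (rotPair h) := by
  rintro ⟨A, hA⟩
  suffices ∃ q, rotSet h q = A from this.imp fun q hq => Subtype.ext hq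
  obtain ⟨a, b, hab, rfl⟩ := Finset.card_eq_two.1 hA
  rcases a with _ | x <;> rcases b with _ | y
  · exact absurd rfl hab
  · exact exists_rotSet_none y
  · rw [Finset.pair_comm]
    exact exists_rotSet_none x
  · exact exists_rotSet_some fun hxy => hab (congrArg some hxy)

theorem rotPair_eq_of_modEq {a b : ℤ} (hab : a ≡ b [ZMOD rotPeriod h]) :
    rotPair h a = rotPair h b := by
  obtain ⟨t, k, hk0, hk, rfl⟩ := exists_row_coord h a
  obtain ⟨c, hc⟩ := hab.dvd
  obtain rfl : b = (t + (2 * h + 1) * c) * (h + 1) + k := by linear_combination hc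
  have residue_add (x : ℤ) : residue h (x + (2 * h + 1) * c) = residue h x :=
    residue_eq_iff.2 (by simp)
  refine Subtype.ext ?_
  simp only [rotPair, rotSet_row hk0 hk, rowEnd]
  rw [add_right_comm, residue_add, add_sub_right_comm, residue_add]

theorem three_mul_lt_rotPeriod (h : ℕ) : 3 * (h : ℤ) < rotPeriod h := by
  unfold rotPeriod
  nlinarith [sq_nonneg (h : ℤ)]

theorem card_vertexPair_rotVertex (h : ℕ) :
    (Fintype.card (VertexPair (RotVertex h)) : ℤ) = rotPeriod h := by
  have hcard : Fintype.card (VertexPair (RotVertex h)) = (2 * h + 1) * (h + 1) := by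
    rw [Fintype.card_finset_len, Fintype.card_option, ZMod.card, Nat.choose_two_right,
      Nat.add_sub_cancel]
    exact Nat.div_eq_of_eq_mul_right two_pos (by ring)
  rw [hcard]
  push_cast
  rfl

theorem isCyclicListing_rotPair (h : ℕ) : IsCyclicListing (rotPair h) (rotPeriod h) := by
  have period_pos : 0 < rotPeriod h := by have := three_mul_lt_rotPeriod h; omega
  have mod_eq (q : ℤ) : rotPair h (q % rotPeriod h) = rotPair h q :=
    rotPair_eq_of_modEq (Int.mod_modEq _ _)
  have mod_mem (q : ℤ) : q % rotPeriod h ∈ Finset.Ico 0 (rotPeriod h) :=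
    Finset.mem_Ico.2 ⟨Int.emod_nonneg _ period_pos.ne', Int.emod_lt_of_pos _ period_pos⟩
  have image_eq : (Finset.Ico 0 (rotPeriod h)).image (rotPair h) = Finset.univ := by
    refine Finset.eq_univ_of_forall fun x => ?_
    obtain ⟨q, rfl⟩ := rotPair_surjective h x
    exact Finset.mem_image.2 ⟨_, mod_mem q, mod_eq q⟩
  have injOn : Set.InjOn (rotPair h) (Finset.Ico 0 (rotPeriod h)) := by
    refine Finset.injOn_of_card_image_eq ?_
    rw [image_eq, Finset.card_univ, Int.card_Ico, sub_zero, ← card_vertexPair_rotVertex,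
      Int.toNat_natCast]
  refine fun a b => ⟨fun hab => ?_, rotPair_eq_of_modEq⟩
  rw [← mod_eq a, ← mod_eq b] at hab
  exact injOn (mod_mem a) (mod_mem b) hab

end Rotation

/-- The rotational sequence transported to `U` along a labelling `σ`. -/
def labelled {h : ℕ} {U : Type*} (σ : RotVertex h ≃ U) (q : ℤ) : VertexPair U :=
  pairCongr σ (rotPair h q)

open Classical in
/-- The star of the pair `x`: all sets of `r` disjoint pairs that contain `x`. -/
noncomputable def matchingStar {U : Type*} [Fintype U] (r : ℕ) (x : VertexPair U) :
    Finset (Finset (VertexPair U)) :=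
  Finset.univ.filter fun M => IsRMatching r M ∧ x ∈ M

section DoubleCounting

variable {h r : ℕ} {U V : Type*}

theorem mem_matchingStar [Fintype U] {x : VertexPair U} {M : Finset (VertexPair U)} :
    M ∈ matchingStar r x ↔ IsRMatching r M ∧ x ∈ M := by
  simp only [matchingStar, Finset.mem_filter, Finset.mem_univ, true_and]

theorem isCyclicListing_labelled (σ : RotVertex h ≃ U) :
    IsCyclicListing (labelled σ) (rotPeriod h) := fun a b =>
  (pairCongr σ).injective.eq_iff.trans (isCyclicListing_rotPair h a b)

theorem labelled_surjective (σ : RotVertex h ≃ U) : Function.Surjective (labelled σ) :=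
  (pairCongr σ).surjective.comp (rotPair_surjective h)

variable [DecidableEq U] {𝓐 : Finset (Finset (VertexPair U))}

theorem window_labelled (σ : RotVertex h ≃ U) (q : ℤ) :
    window (labelled σ) r q = (window (rotPair h) r q).map (pairCongr σ).toEmbedding := by
  rw [Finset.map_eq_image, window, window, Finset.image_image]
  rfl

theorem window_labelled_trans {W : Type*} [DecidableEq W] (σ : RotVertex h ≃ U) (τ : U ≃ W)
    (q : ℤ) : window (labelled (σ.trans τ)) r q =
      (window (labelled σ) r q).map (pairCongr τ).toEmbedding := by
  rw [window_labelled, map_pairCongr_trans, window_labelled]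

theorem isRMatching_window_rotPair (hr : r ≤ h) (q : ℤ) :
    IsRMatching r (window (rotPair h) r q) := by
  refine ⟨fun x hx y hy hxy => ?_, ?_⟩
  · obtain ⟨a, ha, rfl⟩ := mem_window.1 hx
    obtain ⟨b, hb, rfl⟩ := mem_window.1 hy
    exact disjoint_rotSet_of_ne (h := h) (fun hab => hxy (congrArg _ hab))
      (abs_lt.2 ⟨by omega, by omega⟩)
  · have injOn : Set.InjOn (rotPair h) (Finset.Ico q (q + r)) := fun a ha b hb hab => by
      by_contra hne
      rw [Finset.coe_Ico, Set.mem_Ico] at ha hb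
      have hdisj := disjoint_rotSet_of_ne (h := h) hne (abs_lt.2 ⟨by omega, by omega⟩)
      rw [show rotSet h a = rotSet h b from congrArg Subtype.val hab,
        Finset.disjoint_self_iff_empty] at hdisj
      simpa [hdisj] using card_rotSet h b
    rw [window, Finset.card_image_of_injOn injOn]
    simp

theorem isRMatching_window_labelled (hr : r ≤ h) (σ : RotVertex h ≃ U) (q : ℤ) :
    IsRMatching r (window (labelled σ) r q) := by
  rw [window_labelled]
  exact (isRMatching_window_rotPair hr q).map_pairCongr σ

theorem windowCount_labelled_le (hr : r ≤ h)
    (hI : (𝓐 : Set (Finset (VertexPair U))).Intersecting) (σ : RotVertex h ≃ U) :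
    windowCount 𝓐 (labelled σ) (rotPeriod h) r ≤ r := by
  have := three_mul_lt_rotPeriod h
  exact (isCyclicListing_labelled σ).windowCount_le (by omega) hI

variable [Fintype U]

theorem le_windowCount_matchingStar (hr : r ≤ h) (σ : RotVertex h ≃ U) (x : VertexPair U) :
    r ≤ windowCount (matchingStar r x) (labelled σ) (rotPeriod h) r := by
  obtain ⟨p, rfl⟩ := labelled_surjective σ x
  have hcenter : IsWindowCenter (matchingStar r (labelled σ p)) (labelled σ) r p := fun q hq hqp =>
    mem_matchingStar.2 ⟨isRMatching_window_labelled hr σ q, mem_window.2 ⟨p, by omega, rfl⟩⟩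
  have := three_mul_lt_rotPeriod h
  exact hcenter.le_windowCount (isCyclicListing_labelled σ) (by omega)

theorem card_equiv_map_eq_of_isRMatching [Fintype V] [DecidableEq V]
    {R R' : Finset (VertexPair V)} {M M' : Finset (VertexPair U)} (hR : IsRMatching r R)
    (hR' : IsRMatching r R') (hM : IsRMatching r M) (hM' : IsRMatching r M') :
    (Finset.univ.filter fun σ : V ≃ U => R.map (pairCongr σ).toEmbedding = M).card =
      (Finset.univ.filter fun σ : V ≃ U => R'.map (pairCongr σ).toEmbedding = M').card := by
  obtain ⟨ρ, rfl⟩ := hR'.exists_perm_map_eq hR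
  obtain ⟨π, rfl⟩ := hM.exists_perm_map_eq hM'
  refine Finset.card_equiv (ρ.symm.equivCongr π) fun σ => ?_
  have hσ : Equiv.equivCongr ρ.symm π σ = (ρ.trans σ).trans π := rfl
  simp only [Finset.mem_filter, Finset.mem_univ, true_and, hσ, map_pairCongr_trans,
    (Finset.map_injective _).eq_iff]

theorem exists_card_labelling_window_mem (hr : r ≤ h) (σ₀ : RotVertex h ≃ U) :
    ∃ c > 0, ∀ 𝓐 : Finset (Finset (VertexPair U)), (∀ M ∈ 𝓐, IsRMatching r M) → ∀ q,
      (Finset.univ.filter fun σ : RotVertex h ≃ U => window (labelled σ) r q ∈ 𝓐).card =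
        𝓐.card * c := by
  let R := window (rotPair h) r 0
  let labellingsOnto (M : Finset (VertexPair U)) :=
    Finset.univ.filter fun σ : RotVertex h ≃ U => R.map (pairCongr σ).toEmbedding = M
  refine ⟨(labellingsOnto (R.map (pairCongr σ₀).toEmbedding)).card,
    Finset.card_pos.2 ⟨σ₀, by simp [labellingsOnto]⟩, fun 𝓐 h𝓐 q => ?_⟩
  have hR := isRMatching_window_rotPair hr 0
  refine (Finset.card_eq_sum_card_fiberwise (f := fun σ => window (labelled σ) r q)
    fun σ hσ => (Finset.mem_filter.1 hσ).2).trans (Finset.sum_const_nat fun M hM => ?_)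
  rw [Finset.filter_filter, ← card_equiv_map_eq_of_isRMatching
    (isRMatching_window_rotPair hr q) hR (h𝓐 M hM) (hR.map_pairCongr σ₀)]
  congr 1
  ext σ
  simp only [Finset.mem_filter, Finset.mem_univ, true_and, ← window_labelled]
  exact ⟨And.right, fun hσ => ⟨hσ ▸ hM, hσ⟩⟩

theorem exists_sum_windowCount_eq (hr : r ≤ h) (σ₀ : RotVertex h ≃ U) :
    ∃ c > 0, ∀ 𝓐 : Finset (Finset (VertexPair U)), (∀ M ∈ 𝓐, IsRMatching r M) →
      ∑ σ : RotVertex h ≃ U, windowCount 𝓐 (labelled σ) (rotPeriod h) r = 𝓐.card * c := by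
  obtain ⟨c, hc, hcard⟩ := exists_card_labelling_window_mem hr σ₀
  have period_pos : 0 < (rotPeriod h).toNat := by have := three_mul_lt_rotPeriod h; omega
  refine ⟨(rotPeriod h).toNat * c, Nat.mul_pos period_pos hc, fun 𝓐 h𝓐 => ?_⟩
  calc ∑ σ : RotVertex h ≃ U, windowCount 𝓐 (labelled σ) (rotPeriod h) r
      = ∑ q ∈ Finset.Ico 0 (rotPeriod h),
          (Finset.univ.filter fun σ : RotVertex h ≃ U => window (labelled σ) r q ∈ 𝓐).card :=
        Finset.sum_card_bipartiteAbove_eq_sum_card_bipartiteBelow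
          fun (σ : RotVertex h ≃ U) q => window (labelled σ) r q ∈ 𝓐
    _ = ∑ _q ∈ Finset.Ico 0 (rotPeriod h), 𝓐.card * c :=
        Finset.sum_congr rfl fun q _ => hcard 𝓐 h𝓐 q
    _ = 𝓐.card * ((rotPeriod h).toNat * c) := by
        rw [Finset.sum_const, Int.card_Ico, sub_zero, smul_eq_mul, mul_left_comm]

theorem card_le_card_matchingStar (hr : r ≤ h) (σ₀ : RotVertex h ≃ U)
    (hM : ∀ M ∈ 𝓐, IsRMatching r M) (hI : (𝓐 : Set (Finset (VertexPair U))).Intersecting)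
    (x : VertexPair U) : 𝓐.card ≤ (matchingStar r x).card := by
  obtain ⟨c, hc, hsum⟩ := exists_sum_windowCount_eq hr σ₀
  refine Nat.le_of_mul_le_mul_right ?_ hc
  rw [← hsum 𝓐 hM, ← hsum _ fun M hM => (mem_matchingStar.1 hM).1]
  exact Finset.sum_le_sum fun σ _ =>
    (windowCount_labelled_le hr hI σ).trans (le_windowCount_matchingStar hr σ x)

theorem windowCount_eq_of_card_matchingStar_le (hr : r ≤ h) (hM : ∀ M ∈ 𝓐, IsRMatching r M)
    (hI : (𝓐 : Set (Finset (VertexPair U))).Intersecting) {x : VertexPair U}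
    (hx : (matchingStar r x).card ≤ 𝓐.card) (σ : RotVertex h ≃ U) :
    windowCount 𝓐 (labelled σ) (rotPeriod h) r = r := by
  obtain ⟨c, -, hsum⟩ := exists_sum_windowCount_eq hr σ
  have le_count (σ : RotVertex h ≃ U) :=
    (windowCount_labelled_le hr hI σ).trans (le_windowCount_matchingStar hr σ x)
  have sum_eq := (Finset.sum_le_sum fun σ _ => le_count σ).antisymm <| by
    rw [hsum 𝓐 hM, hsum _ fun M hM => (mem_matchingStar.1 hM).1]
    exact Nat.mul_le_mul_right c hx
  have count_eq :=
    (Finset.sum_eq_sum_iff_of_le fun σ _ => le_count σ).1 sum_eq σ (Finset.mem_univ σ)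
  exact (windowCount_labelled_le hr hI σ).antisymm
    (count_eq ▸ le_windowCount_matchingStar hr σ x)

end DoubleCounting

section CenterAtZero

variable {h r : ℕ} {U : Type*} [DecidableEq U] {𝓐 : Finset (Finset (VertexPair U))}

theorem exists_perm_pairCongr_rotPair (hr : r < h) (p p' : ℤ) :
    ∃ ρ : Equiv.Perm (RotVertex h), ∀ d : ℤ, 0 ≤ d → d ≤ r →
      pairCongr ρ (rotPair h (p - d)) = rotPair h (p' - d) := by
  have disjoint_block (p : ℤ) :
      Pairwise (Function.onFun Disjoint fun d : Set.Icc (0 : ℤ) r => rotSet h (p - d)) := by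
    rintro ⟨d, hd⟩ ⟨d', hd'⟩ hne
    rw [Set.mem_Icc] at hd hd'
    have hdd' : d ≠ d' := fun heq => hne (Subtype.ext heq)
    exact disjoint_rotSet_of_ne (a := p - d) (b := p - d') (by omega)
      (abs_lt.2 ⟨by omega, by omega⟩)
  obtain ⟨ρ, hρ⟩ := exists_perm_map_eq (disjoint_block p) (disjoint_block p')
    fun d => (card_rotSet h _).trans (card_rotSet h _).symm
  exact ⟨ρ, fun d hd hdr => Subtype.ext (hρ ⟨d, hd, hdr⟩)⟩

theorem IsWindowCenter.exists_isWindowCenter (hr : r < h)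
    (hI : (𝓐 : Set (Finset (VertexPair U))).Intersecting)
    (hc : ∀ σ : RotVertex h ≃ U, IsCentered 𝓐 (labelled σ) r) {σ : RotVertex h ≃ U} {p : ℤ}
    (hp : IsWindowCenter 𝓐 (labelled σ) r p) (p' : ℤ) :
    ∃ σ' : RotVertex h ≃ U, IsWindowCenter 𝓐 (labelled σ') r p' := by
  obtain ⟨ρ, hρ⟩ := exists_perm_pairCongr_rotPair hr p' p
  have := three_mul_lt_rotPeriod h
  refine ⟨ρ.trans σ, hp.transfer_backward (isCyclicListing_labelled σ) (by omega) hI (hc _)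
    fun d hd hdr => ?_⟩
  rw [labelled, labelled, pairCongr_trans, hρ d hd hdr]

/-- Each window position meets `𝓐` in equally many labellings. Hence if in some labelling the
family is left between positions `q` and `q + 1`, then in another one it is entered there. -/
theorem IsWindowCenter.exists_isWindowCenter_add (hr : r ≤ h) (hr0 : 0 < r)
    (hM : ∀ M ∈ 𝓐, IsRMatching r M) (hI : (𝓐 : Set (Finset (VertexPair U))).Intersecting)
    (hc : ∀ σ : RotVertex h ≃ U, IsCentered 𝓐 (labelled σ) r) {σ : RotVertex h ≃ U} {q : ℤ}
    (hq : IsWindowCenter 𝓐 (labelled σ) r q) :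
    ∃ σ' : RotVertex h ≃ U, IsWindowCenter 𝓐 (labelled σ') r (q + r) := by
  have : Fintype U := Fintype.ofEquiv _ σ
  by_contra! hnone
  obtain ⟨c, -, hcard⟩ := exists_card_labelling_window_mem hr σ
  let labellingsAt (q : ℤ) :=
    Finset.univ.filter fun σ : RotVertex h ≃ U => window (labelled σ) r q ∈ 𝓐
  have mem_labellingsAt {σ q} : σ ∈ labellingsAt q ↔ window (labelled σ) r q ∈ 𝓐 := by
    simp only [labellingsAt, Finset.mem_filter, Finset.mem_univ, true_and]
  have subset : labellingsAt (q + 1) ⊆ labellingsAt q := fun σ' hσ' => by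
    rw [mem_labellingsAt] at hσ' ⊢
    by_contra hout
    exact hnone σ' ((hc σ').isWindowCenter_add hout hσ')
  have eq : labellingsAt (q + 1) = labellingsAt q := Finset.eq_of_subset_of_card_le subset <|
    ((hcard 𝓐 hM q).trans (hcard 𝓐 hM (q + 1)).symm).le
  have := three_mul_lt_rotPeriod h
  refine hq.window_add_one_notMem hr0 (isCyclicListing_labelled σ) (by omega) hI ?_
  exact mem_labellingsAt.1 (eq ▸ mem_labellingsAt.2 (hq q (by omega) le_rfl))

theorem exists_isWindowCenter_zero (hr : r ≤ h) (hr0 : 0 < r)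
    (hM : ∀ M ∈ 𝓐, IsRMatching r M) (hI : (𝓐 : Set (Finset (VertexPair U))).Intersecting)
    (hc : ∀ σ : RotVertex h ≃ U, IsCentered 𝓐 (labelled σ) r) {σ : RotVertex h ≃ U} {p : ℤ}
    (hp : IsWindowCenter 𝓐 (labelled σ) r p) :
    ∃ σ' : RotVertex h ≃ U, IsWindowCenter 𝓐 (labelled σ') r 0 := by
  rcases hr.lt_or_eq with hlt | rfl
  · exact hp.exists_isWindowCenter hlt hI hc 0
  · have iterate (m : ℕ) :
        ∃ σ' : RotVertex r ≃ U, IsWindowCenter 𝓐 (labelled σ') r (p + m * r) := by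
      induction m with
      | zero => exact ⟨σ, by simpa using hp⟩
      | succ m ih =>
        obtain ⟨σ', hσ'⟩ := ih
        obtain ⟨σ'', hσ''⟩ := hσ'.exists_isWindowCenter_add hr hr0 hM hI hc
        exact ⟨σ'', by convert hσ'' using 1; push_cast; ring⟩
    have period_pos : 0 < rotPeriod r := by have := three_mul_lt_rotPeriod r; omega
    obtain ⟨k, hk⟩ := Int.eq_ofNat_of_zero_le (Int.emod_nonneg p period_pos.ne')
    obtain ⟨σ', hσ'⟩ := iterate ((2 * r + 3) * k)
    -- The period exceeds `r * (2 * r + 3)` by one.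
    have hmod : p + ((2 * r + 3) * k : ℕ) * r ≡ 0 [ZMOD rotPeriod r] := calc
      p + ((2 * r + 3) * k : ℕ) * r ≡ k + ((2 * r + 3) * k : ℕ) * r [ZMOD rotPeriod r] :=
        Int.ModEq.add_right _ (hk ▸ (Int.mod_modEq p _).symm)
      _ = rotPeriod r * k := by push_cast; ring
      _ ≡ 0 [ZMOD rotPeriod r] := Int.modEq_zero_iff_dvd.2 (dvd_mul_right _ _)
    exact ⟨σ', (isCyclicListing_labelled σ').isWindowCenter_of_modEq hmod hσ'⟩

end CenterAtZero

/-- The permutations of the rotational vertices by which a labelling can be modified without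
affecting whether position `0` is a window center. -/
def centerPreserving {U : Type*} [DecidableEq U] (𝓐 : Finset (Finset (VertexPair U)))
    (h r : ℕ) : Subgroup (Equiv.Perm (RotVertex h)) where
  carrier := {τ | ∀ σ : RotVertex h ≃ U,
    IsWindowCenter 𝓐 (labelled (τ.trans σ)) r 0 ↔ IsWindowCenter 𝓐 (labelled σ) r 0}
  one_mem' _ := Iff.rfl
  mul_mem' {τ _} hτ hτ' σ := (hτ' (τ.trans σ)).trans (hτ σ)
  inv_mem' {τ} hτ σ := by
    have hcancel : τ.trans ((τ⁻¹ : Equiv.Perm _).trans σ) = σ := by ext; simp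
    rw [← hτ, hcancel]

section CenterPreserving

variable {h r : ℕ} {U : Type*} [DecidableEq U] {𝓐 : Finset (Finset (VertexPair U))}

theorem mem_centerPreserving_of_fixes (hr : r ≤ h)
    (hI : (𝓐 : Set (Finset (VertexPair U))).Intersecting)
    (hc : ∀ σ : RotVertex h ≃ U, IsCentered 𝓐 (labelled σ) r) {τ : Equiv.Perm (RotVertex h)}
    (hτ : (∀ d : ℤ, 0 ≤ d → d ≤ h → pairCongr τ (rotPair h d) = rotPair h d) ∨
      ∀ d : ℤ, 0 ≤ d → d ≤ h → pairCongr τ (rotPair h (-d)) = rotPair h (-d)) :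
    τ ∈ centerPreserving 𝓐 h r := by
  intro σ
  have := three_mul_lt_rotPeriod h
  have labelled_eq {q : ℤ} (hq : pairCongr τ (rotPair h q) = rotPair h q) :
      labelled (τ.trans σ) q = labelled σ q := by
    rw [labelled, pairCongr_trans, hq, labelled]
  rcases hτ with hforward | hbackward
  · have agree (d : ℤ) (hd : 0 ≤ d) (hdr : d ≤ r) :
        labelled (τ.trans σ) (0 + d) = labelled σ (0 + d) :=
      labelled_eq (by rw [zero_add]; exact hforward d hd (by omega))
    exact ⟨fun hp => hp.transfer_forward (isCyclicListing_labelled _) (by omega) hI (hc _) agree,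
      fun hp => hp.transfer_forward (isCyclicListing_labelled _) (by omega) hI (hc _)
        fun d hd hdr => (agree d hd hdr).symm⟩
  · have agree (d : ℤ) (hd : 0 ≤ d) (hdr : d ≤ r) :
        labelled (τ.trans σ) (0 - d) = labelled σ (0 - d) :=
      labelled_eq (by rw [zero_sub]; exact hbackward d hd (by omega))
    exact ⟨fun hp => hp.transfer_backward (isCyclicListing_labelled _) (by omega) hI (hc _) agree,
      fun hp => hp.transfer_backward (isCyclicListing_labelled _) (by omega) hI (hc _)
        fun d hd hdr => (agree d hd hdr).symm⟩

theorem swap_mem_centerPreserving (hr : r ≤ h)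
    (hI : (𝓐 : Set (Finset (VertexPair U))).Intersecting)
    (hc : ∀ σ : RotVertex h ≃ U, IsCentered 𝓐 (labelled σ) r) {a b : RotVertex h} {q : ℤ}
    (hq : -h < q) (hq' : q ≤ h) (hab : rotSet h q = {a, b}) :
    Equiv.swap a b ∈ centerPreserving 𝓐 h r := by
  have fixes {d : ℤ} (hd : d ≠ q → Disjoint (rotSet h q) (rotSet h d)) :
      pairCongr (Equiv.swap a b) (rotPair h d) = rotPair h d :=
    pairCongr_swap_eq_self (x := rotPair h q) hab <|
      (eq_or_ne d q).imp (congrArg (rotPair h)) hd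
  refine mem_centerPreserving_of_fixes hr hI hc ?_
  rcases lt_or_ge q 0 with hneg | hnonneg
  · exact .inr fun d hd hdh => fixes fun hne =>
      disjoint_rotSet_of_ne hne.symm (abs_lt.2 ⟨by omega, by omega⟩)
  · have disjoint_of_lt {i j : ℤ} (hi : 0 ≤ i) (hij : i < j) (hj : j ≤ h) :
        Disjoint (rotSet h i) (rotSet h j) := by
      simpa using disjoint_rotSet_rows (t := 0) (by omega) hj hi (by omega) (.inl ⟨rfl, hij⟩)
    refine .inl fun d hd hdh => fixes fun hne => ?_
    rcases lt_or_gt_of_ne hne with hlt | hgt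
    · exact (disjoint_of_lt hd hlt hq').symm
    · exact disjoint_of_lt hnonneg hgt hdh

theorem rotSet_zero (h : ℕ) : rotSet h 0 = {none, residue h 0} := by
  simpa [rowEnd] using rotSet_row (h := h) (t := 0) le_rfl (by omega)

theorem swap_infinity_mem_centerPreserving (hr : r ≤ h)
    (hI : (𝓐 : Set (Finset (VertexPair U))).Intersecting)
    (hc : ∀ σ : RotVertex h ≃ U, IsCentered 𝓐 (labelled σ) r) (hh : 0 < h) :
    Equiv.swap none (residue h 0) ∈ centerPreserving 𝓐 h r :=
  swap_mem_centerPreserving hr hI hc (by omega) (by omega) (rotSet_zero h)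

theorem swap_neg_mem_centerPreserving (hr : r ≤ h)
    (hI : (𝓐 : Set (Finset (VertexPair U))).Intersecting)
    (hc : ∀ σ : RotVertex h ≃ U, IsCentered 𝓐 (labelled σ) r) {j : ℤ} (hj0 : 0 < j) (hj : j ≤ h) :
    Equiv.swap (residue h j) (residue h (-j)) ∈ centerPreserving 𝓐 h r := by
  refine swap_mem_centerPreserving hr hI hc (q := 0 * (h + 1) + j) (by omega) (by omega) ?_
  rw [rotSet_row hj0.le hj, rowEnd, if_neg hj0.ne', zero_add, zero_sub]

theorem swap_neg_sub_two_mem_centerPreserving (hr : r ≤ h)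
    (hI : (𝓐 : Set (Finset (VertexPair U))).Intersecting)
    (hc : ∀ σ : RotVertex h ≃ U, IsCentered 𝓐 (labelled σ) r) {j : ℤ} (hj0 : 0 < j) (hj : j < h) :
    Equiv.swap (residue h j) (residue h (-(j + 2))) ∈ centerPreserving 𝓐 h r := by
  refine swap_mem_centerPreserving hr hI hc (q := -1 * (h + 1) + (j + 1)) (by omega) (by omega) ?_
  rw [rotSet_row (by omega) (by omega), rowEnd, if_neg (by omega)]
  congr 2 <;> ring_nf

theorem swap_last_mem_centerPreserving (hr : r ≤ h)
    (hI : (𝓐 : Set (Finset (VertexPair U))).Intersecting)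
    (hc : ∀ σ : RotVertex h ≃ U, IsCentered 𝓐 (labelled σ) r) (i : ℕ) (hi : i < h) :
    Equiv.swap (residue h (h - i)) (residue h h) ∈ centerPreserving 𝓐 h r := by
  induction i using Nat.twoStepInduction with
  | zero =>
    rw [Nat.cast_zero, sub_zero, Equiv.swap_self]
    exact one_mem _
  | one =>
    have last_eq : residue h (-(h - 1 + 2)) = residue h h :=
      residue_eq_iff.2 (Int.modEq_iff_dvd.2 ⟨1, by ring⟩)
    have := swap_neg_sub_two_mem_centerPreserving hr hI hc (j := h - 1) (by omega) (by omega)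
    rwa [last_eq] at this
  | more i ih _ =>
    have step := swap_neg_sub_two_mem_centerPreserving hr hI hc (j := h - (i + 2))
      (by omega) (by omega)
    have flip := swap_neg_mem_centerPreserving hr hI hc (j := h - i) (by omega) (by omega)
    rw [Equiv.swap_comm] at flip
    rw [sub_add_eq_sub_sub, sub_add_cancel] at step
    have := SubmonoidClass.swap_mem_trans _ (SubmonoidClass.swap_mem_trans _ step flip)
      (ih (by omega))
    simpa [sub_add_eq_sub_sub] using this

theorem swap_residue_mem_centerPreserving (hr : r ≤ h)
    (hI : (𝓐 : Set (Finset (VertexPair U))).Intersecting)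
    (hc : ∀ σ : RotVertex h ≃ U, IsCentered 𝓐 (labelled σ) r) {a : RotVertex h}
    (ha : a ∉ rotSet h 0) : Equiv.swap a (residue h h) ∈ centerPreserving 𝓐 h r := by
  have swap_pos {j : ℤ} (hj0 : 0 < j) (hj : j ≤ h) :
      Equiv.swap (residue h j) (residue h h) ∈ centerPreserving 𝓐 h r := by
    obtain ⟨i, hi⟩ := Int.eq_ofNat_of_zero_le (sub_nonneg.2 hj)
    obtain rfl : j = h - i := by omega
    exact swap_last_mem_centerPreserving hr hI hc i (by omega)
  rw [rotSet_zero, Finset.mem_insert, Finset.mem_singleton, not_or] at ha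
  obtain ⟨x, rfl⟩ := Option.ne_none_iff_exists'.1 ha.1
  have hx : residue h x.valMinAbs = some x := congrArg some (ZMod.coe_valMinAbs x)
  have hle : x.valMinAbs.natAbs ≤ h := (ZMod.natAbs_valMinAbs_le _).trans (by omega)
  rw [← hx] at ha ⊢
  have hne : x.valMinAbs ≠ 0 := fun h0 => ha.2 (congrArg _ h0)
  rcases lt_or_gt_of_ne hne with hneg | hpos
  · have flip := swap_neg_mem_centerPreserving hr hI hc (j := -x.valMinAbs) (by omega) (by omega)
    rw [neg_neg, Equiv.swap_comm] at flip
    exact SubmonoidClass.swap_mem_trans _ flip (swap_pos (by omega) (by omega))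
  · exact swap_pos hpos (by omega)

theorem mem_centerPreserving_of_pairCongr_zero (hr : r ≤ h)
    (hI : (𝓐 : Set (Finset (VertexPair U))).Intersecting)
    (hc : ∀ σ : RotVertex h ≃ U, IsCentered 𝓐 (labelled σ) r) (hh : 0 < h)
    {τ : Equiv.Perm (RotVertex h)} (hτ : pairCongr τ (rotPair h 0) = rotPair h 0) :
    τ ∈ centerPreserving 𝓐 h r := by
  refine mem_subgroup_of_forall_swap_mem fun a => ?_
  have mem_iff : τ a ∈ rotSet h 0 ↔ a ∈ rotSet h 0 := by
    have := mem_pairCongr_iff (σ := τ) (x := rotPair h 0) (a := a)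
    rwa [hτ] at this
  by_cases ha : a ∈ rotSet h 0
  · have hτa := mem_iff.2 ha
    have hswap := swap_infinity_mem_centerPreserving hr hI hc hh
    rw [rotSet_zero, Finset.mem_insert, Finset.mem_singleton] at ha hτa
    rcases ha with ha | ha <;> rcases hτa with hτa | hτa <;> rw [hτa, ha]
    · exact Equiv.swap_self (none : RotVertex h) ▸ one_mem _
    · exact hswap
    · exact Equiv.swap_comm none (residue h 0) ▸ hswap
    · exact Equiv.swap_self (residue h 0) ▸ one_mem _
  · have hτa := swap_residue_mem_centerPreserving hr hI hc fun hmem => ha (mem_iff.1 hmem)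
    rw [Equiv.swap_comm] at hτa
    exact SubmonoidClass.swap_mem_trans _ (swap_residue_mem_centerPreserving hr hI hc ha) hτa

/-- Any set of disjoint pairs containing the central pair is the window at `0` of a modified
labelling, whose center is still at `0`. -/
theorem IsWindowCenter.mem_of_labelled_zero_mem (hr : r ≤ h) (hr0 : 0 < r)
    (hI : (𝓐 : Set (Finset (VertexPair U))).Intersecting)
    (hc : ∀ σ : RotVertex h ≃ U, IsCentered 𝓐 (labelled σ) r) {σ : RotVertex h ≃ U}
    (hσ : IsWindowCenter 𝓐 (labelled σ) r 0) {M : Finset (VertexPair U)} (hM : IsRMatching r M)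
    (hmem : labelled σ 0 ∈ M) : M ∈ 𝓐 := by
  have : Finite U := Finite.of_equiv _ σ
  have hwindow : labelled σ 0 ∈ window (labelled σ) r 0 := mem_window.2 ⟨0, by omega, rfl⟩
  obtain ⟨π, rfl, hπ⟩ :=
    (isRMatching_window_labelled hr σ 0).exists_perm_map_eq_fixing hM hwindow hmem
  let τ : Equiv.Perm (RotVertex h) := (σ.trans π).trans σ.symm
  have τ_trans : τ.trans σ = σ.trans π := by ext; simp [τ]
  have τ_fixes : pairCongr τ (rotPair h 0) = rotPair h 0 := by
    refine (pairCongr σ).injective ?_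
    rw [← pairCongr_trans, τ_trans]
    exact (pairCongr_trans σ π _).trans hπ
  have hcenter : IsWindowCenter 𝓐 (labelled (τ.trans σ)) r 0 :=
    (mem_centerPreserving_of_pairCongr_zero hr hI hc (by omega) τ_fixes σ).2 hσ
  rw [← window_labelled_trans, ← τ_trans]
  exact hcenter 0 (by omega) le_rfl

end CenterPreserving

theorem exists_eq_matchingStar {h r : ℕ} {U : Type*} [DecidableEq U] [Fintype U]
    {𝓐 : Finset (Finset (VertexPair U))} (hr : r ≤ h) (σ₀ : RotVertex h ≃ U)
    (hM : ∀ M ∈ 𝓐, IsRMatching r M) (hI : (𝓐 : Set (Finset (VertexPair U))).Intersecting)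
    {x : VertexPair U} (hx : (matchingStar r x).card ≤ 𝓐.card) :
    ∃ y, 𝓐 = matchingStar r y := by
  suffices ∃ y, matchingStar r y ⊆ 𝓐 from this.imp fun y hy =>
    (Finset.eq_of_subset_of_card_le hy (card_le_card_matchingStar hr σ₀ hM hI y)).symm
  rcases (matchingStar r x).eq_empty_or_nonempty with hempty | ⟨M, hMx⟩
  · exact ⟨x, hempty ▸ Finset.empty_subset 𝓐⟩
  obtain ⟨hMr, hxM⟩ := mem_matchingStar.1 hMx
  have hr0 : 0 < r := hMr.2 ▸ Finset.card_pos.2 ⟨x, hxM⟩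
  have count_eq (σ : RotVertex h ≃ U) := windowCount_eq_of_card_matchingStar_le hr hM hI hx σ
  have := three_mul_lt_rotPeriod h
  have centered (σ : RotVertex h ≃ U) : IsCentered 𝓐 (labelled σ) r :=
    (isCyclicListing_labelled σ).isCentered_of_windowCount_eq (by omega) hI (count_eq σ)
  obtain ⟨a, ha⟩ := Finset.card_pos.1 ((count_eq σ₀).symm ▸ hr0)
  obtain ⟨p, -, -, hp⟩ := centered σ₀ a (Finset.mem_filter.1 ha).2
  obtain ⟨σ, hσ⟩ := exists_isWindowCenter_zero hr hr0 hM hI centered hp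
  refine ⟨labelled σ 0, fun M' hM' => ?_⟩
  obtain ⟨hMr', hmem⟩ := mem_matchingStar.1 hM'
  exact hσ.mem_of_labelled_zero_mem hr hr0 hI centered hMr' hmem

section Kneser

variable {m r : ℕ}

theorem mem_indepSetFinset_compl_kneserGraph {M : Finset (VertexPair (Fin m))} :
    M ∈ (kneserGraph m 2)ᶜ.indepSetFinset r ↔ IsRMatching r M := by
  have not_adj_iff {x y : VertexPair (Fin m)} (hxy : x ≠ y) :
      ¬ (kneserGraph m 2)ᶜ.Adj x y ↔ Disjoint (x : Finset (Fin m)) y := by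
    simp [SimpleGraph.compl_adj, kneserGraph, hxy]
  rw [SimpleGraph.mem_indepSetFinset_iff, SimpleGraph.isNIndepSet_iff]
  exact and_congr_left' <| forall₅_congr fun x _ y _ hxy => not_adj_iff hxy

theorem indepStar_compl_kneserGraph (x : VertexPair (Fin m)) :
    (kneserGraph m 2)ᶜ.indepStar r x = matchingStar r x := by
  ext M
  rw [SimpleGraph.indepStar, Finset.mem_filter, mem_indepSetFinset_compl_kneserGraph,
    mem_matchingStar]

theorem isIntersectingIndepFamily_indepStar {V : Type*} [Fintype V] [DecidableEq V]
    (G : SimpleGraph V) [DecidableRel G.Adj] (r : ℕ) (v : V) :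
    G.IsIntersectingIndepFamily r (G.indepStar r v) :=
  ⟨Finset.filter_subset _ _, fun _ hs _ ht =>
    Finset.not_disjoint_iff.2 ⟨v, (Finset.mem_filter.1 hs).2, (Finset.mem_filter.1 ht).2⟩⟩

end Kneser

theorem mainTheorem3 (n r : ℕ) (hr : r < n) :
    (kneserGraph (2 * n) 2)ᶜ.IndepIsStrictlyEKR r := by
  obtain ⟨h, rfl⟩ := Nat.exists_eq_add_one_of_ne_zero hr.ne_bot
  have hrh : r ≤ h := Nat.lt_succ_iff.1 hr
  have σ₀ : RotVertex h ≃ Fin (2 * (h + 1)) := Fintype.equivOfCardEq <| by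
    rw [Fintype.card_option, ZMod.card, Fintype.card_fin]
    ring
  let x₀ := labelled σ₀ 0
  have matchings {𝓐} (h𝓐 : (kneserGraph (2 * (h + 1)) 2)ᶜ.IsIntersectingIndepFamily r 𝓐) :
      ∀ M ∈ 𝓐, IsRMatching r M := fun M hM => mem_indepSetFinset_compl_kneserGraph.1 (h𝓐.1 hM)
  refine ⟨fun 𝓐 h𝓐 => ?_, fun 𝓐 h𝓐 hmax => ?_⟩
  · calc 𝓐.card ≤ (matchingStar r x₀).card :=
          card_le_card_matchingStar hrh σ₀ (matchings h𝓐) h𝓐.2 x₀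
      _ = ((kneserGraph (2 * (h + 1)) 2)ᶜ.indepStar r x₀).card := by
          rw [indepStar_compl_kneserGraph]
      _ ≤ _ := Finset.le_sup (f := fun v => Finset.card (SimpleGraph.indepStar _ r v))
          (Finset.mem_univ x₀)
  · have star_le : (matchingStar r x₀).card ≤ 𝓐.card :=
      indepStar_compl_kneserGraph x₀ ▸ hmax _ (isIntersectingIndepFamily_indepStar _ r x₀)
    obtain ⟨y, hy⟩ := exists_eq_matchingStar hrh σ₀ (matchings h𝓐) h𝓐.2 star_le
    exact ⟨y, hy.trans (indepStar_compl_kneserGraph y).symm⟩
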